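/- Let $C2$ be the cubic spherical 3-manifold obtained from the solid cube $[-1,1]^3$, with coordinates $(y_1,y_2,y_3)$ and faces $F1:y_1=1$, $F6:y_1=-1$, $F3:y_2=1$, $F5:y_2=-1$, $F2:y_3=1$, $F4:y_3=-1$, as the quotient space by the three face gluings $$F3\to F1:\ (a,1,b)\sim(1,b,-a),\qquad F4\to F2:\ (a,b,-1)\sim(-b,a,1),\qquad F5\to F6:\ (a,-1,b)\sim(-1,-b,a).$$ Let $S^3\subset\mathbb R^4$ have coordinates $x=(x_0,x_1,x_2,x_3)$, and identify the cube with the spherical cubic prototile $K=\{x\in S^3:|x_j|\le x_0\text{ for all }j\}$ by sending $y$ to $(1,y)/\|(1,y)\|$. Let $g_1\in O(4,\mathbb R)$ be $g_1x=(x_1,-x_3,x_0,x_2)$; its inverse maps the face $F3$ of $K$ to $F1$ by the gluing above. Let $G<O(4,\mathbb R)$ be the Coxeter group generated by the reflections $W_1,\dots,W_4$ in the hyperplanes orthogonal to $(0,0,0,1)$, $(0,0,-\sqrt{1/2},\sqrt{1/2})$, $(0,\sqrt{1/2},-\sqrt{1/2},0)$, $(-\sqrt{1/2},\sqrt{1/2},0,0)$.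 Theorem. (1) $\pi_1(C2)$ (at every base point) is isomorphic to the cyclic group $C_8$ of order $8$. (2) There is a universal covering $q:S^3\to C2$ which on $K$ is the quotient map of the cube onto $C2$, and whose group of deck transformations, $\mathrm{deck}(C2)=\{h:S^3\to S^3\text{ homeomorphism}, q\circ h=q\}$, is exactly the group $C_8=\langle g_1\rangle=\{g_1^t: t=1,\dots,8\}$, $g_1^8=e$, cyclic of order $8$. (3) The actions of the powers of $g_1$ are as follows. Put $a=\exp(\pi i/4)$ and let $\bar a$ be its complex conjugate. In each row, $(\epsilon,p)$ means $(g_1^tx)_i=\epsilon_i x_{p(i)}$ with $p$ in cycle form, $w_l^t$ and $w_r^t$ lie in $SU(2)$ and are the $t$-th powers of $w_l$ and $w_r$ (the matrices of the first row), and in the coordinates $u(x)=\begin{pmatrix}z_1&z_2\\-\bar z_2&\bar z_1\end{pmatrix}$, $z_1=x_0-ix_3$, $z_2=-x_2-ix_1$, one has $u(g_1^tx)=(w_l^t)^{-1}u(x)\,w_r^t$. $$\begin{array}{l|lllll} t&g_1^t x&w_l^t&w_r^t&\epsilon&p\\\hline 1&(x_1,-x_3,x_0,x_2)&\mathrm{diag}(-\bar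 a,-a)&\begin{pmatrix}0&-a^3\\-a&0\end{pmatrix}&(+-++)&(0132)\\ 2&(-x_3,-x_2,x_1,x_0)&\mathrm{diag}(\bar a^2,a^2)&\mathrm{diag}(-1,-1)&(--++)&(03)(12)\\ 3&(-x_2,-x_0,-x_3,x_1)&\mathrm{diag}(-\bar a^3,-a^3)&\begin{pmatrix}0&a^3\\a&0\end{pmatrix}&(---+)&(0231)\\ 4&(-x_0,-x_1,-x_2,-x_3)&\mathrm{diag}(-1,-1)&\mathrm{diag}(1,1)&(----)&e\\ 5&(-x_1,x_3,-x_0,-x_2)&\mathrm{diag}(\bar a,a)&\begin{pmatrix}0&-a^3\\-a&0\end{pmatrix}&(-+--)&(0132)\\ 6&(x_3,x_2,-x_1,-x_0)&\mathrm{diag}(-\bar a^2,-a^2)&\mathrm{diag}(-1,-1)&(++--)&(03)(12)\\ 7&(x_2,x_0,x_3,-x_1)&\mathrm{diag}(\bar a^3,a^3)&\begin{pmatrix}0&a^3\\a&0\end{pmatrix}&(+++-)&(0231)\\ 8&(x_0,x_1,x_2,x_3)&\mathrm{diag}(1,1)&\mathrm{diag}(1,1)&(++++)&e \end{array}$$ (4)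 The deck transformations act without fixed points: if $h\in\mathrm{deck}(C2)$ and $h\ne e$, then $h(x)\ne x$ for all $x\in S^3$. They generate the 8-cell from the prototile: $h\mapsto h(K)$ is a bijection from $\mathrm{deck}(C2)$ onto the set of the eight spherical cubes $\{x\in S^3:|x_j|\le s\,x_i\text{ for all }j\}$, $i\in\{0,1,2,3\}$, $s=\pm1$. These eight cubes cover $S^3$ and have pairwise disjoint interiors. (5) $G$ has the Coxeter diagram $\circ\overset{4}{-}\circ\overset{3}{-}\circ\overset{3}{-}\circ$ (that is, $W_sW_t$ has order $1$ for $s=t$, order $4,3,3$ for $\{s,t\}=\{1,2\},\{2,3\},\{3,4\}$, and order $2$ otherwise), and is the hyperoctahedral group of all $2^4\,4!=384$ signed permutations of the coordinates. The subgroup chain $O(4,\mathbb R)>G>C_8$ holds, with proper inclusions. -/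

import Mathlib

open scoped Matrix

/-- Euclidean 4-space, with coordinates `x 0, x 1, x 2, x 3`. -/
abbrev E4 : Type := EuclideanSpace ℝ (Fin 4)

/-- The 3-sphere. -/
abbrev S3 : Type := Metric.sphere (0 : E4) 1

/-- The orthogonal group `O(4, ℝ)`, as the group of linear isometries of Euclidean 4-space. -/
abbrev O4 : Type := E4 ≃ₗᵢ[ℝ] E4

/-! ### The manifold `C2` as a cube with its faces glued in pairs -/

/-- The solid cube `[-1, 1]³`. Its faces are enumerated as
`F1 : y 0 = 1`, `F6 : y 0 = -1`, `F3 : y 1 = 1`, `F5 : y 1 = -1`, `F2 : y 2 = 1`,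
`F4 : y 2 = -1`. -/
abbrev Cube : Type := {y : Fin 3 → ℝ // ∀ i, |y i| ≤ 1}

/-- The three face gluings `F3 → F1`, `F4 → F2`, `F5 → F6`. -/
inductive CubeGlue : (Fin 3 → ℝ) → (Fin 3 → ℝ) → Prop
  | F3_F1 (a b : ℝ) : CubeGlue ![a, 1, b] ![1, b, -a]
  | F4_F2 (a b : ℝ) : CubeGlue ![a, b, -1] ![-b, a, 1]
  | F5_F6 (a b : ℝ) : CubeGlue ![a, -1, b] ![-1, -b, a]

/-- The cubic spherical manifold `C2`: the quotient space of the cube by the equivalence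
relation generated by the face gluings. -/
abbrev C2 : Type := Quot (fun y z : Cube => CubeGlue y.1 z.1)

/-! ### The action of `O(4, ℝ)` on the 3-sphere -/

/-- The action of `O(4, ℝ)` on the 3-sphere by homeomorphisms. -/
noncomputable def sphereAct : O4 →* (S3 ≃ₜ S3) where
  toFun A :=
    { toFun := fun x => ⟨A x.1, by simp⟩
      invFun := fun x => ⟨A.symm x.1, by simp⟩
      left_inv := fun x => by simp
      right_inv := fun x => by simp
      continuous_toFun := by fun_prop
      continuous_invFun := by fun_prop }
  map_one' := by ext; rfl
  map_mul' A B := by ext; rfl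

/-- The signed coordinate permutation `x ↦ (ε i * x (p i))_i`. -/
noncomputable def signedPerm (ε : Fin 4 → ℤˣ) (p : Equiv.Perm (Fin 4)) : O4 where
  toFun x := WithLp.toLp 2 fun i => ((ε i : ℤ) : ℝ) * x (p i)
  invFun x := WithLp.toLp 2 fun i => ((ε (p.symm i) : ℤ) : ℝ) * x (p.symm i)
  map_add' x y := by ext i; simp [mul_add]
  map_smul' c x := by ext i; simp [mul_left_comm]
  left_inv x := by
    ext i
    have h : ((ε (p.symm i) : ℤ) : ℝ) * ((ε (p.symm i) : ℤ) : ℝ) = 1 := by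
      rcases Int.units_eq_one_or (ε (p.symm i)) with h | h <;> simp [h]
    simp [← mul_assoc, h]
  right_inv x := by
    ext i
    have h : ((ε i : ℤ) : ℝ) * ((ε i : ℤ) : ℝ) = 1 := by
      rcases Int.units_eq_one_or (ε i) with h | h <;> simp [h]
    simp [← mul_assoc, h]
  norm_map' x := by
    have h : ∀ i, ‖((ε i : ℤ) : ℝ) * x (p i)‖ = ‖x (p i)‖ := by
      intro i
      rcases Int.units_eq_one_or (ε i) with h | h <;> simp [h]
    simp only [LinearEquiv.coe_mk, LinearMap.coe_mk, AddHom.coe_mk, EuclideanSpace.norm_eq, h]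
    congr 1
    exact Equiv.sum_comp p fun i => ‖x i‖ ^ 2

/-! ### The Coxeter group `G` -/

/-- The four Weyl vectors (indices `0, 1, 2, 3` stand for `s = 1, 2, 3, 4`). -/
noncomputable def weylVector : Fin 4 → E4 :=
  ![!₂[0, 0, 0, 1],
    !₂[0, 0, -√(1 / 2), √(1 / 2)],
    !₂[0, √(1 / 2), -√(1 / 2), 0],
    !₂[-√(1 / 2), √(1 / 2), 0, 0]]

/-- The Weyl reflection in the hyperplane orthogonal to a Weyl vector. -/
noncomputable def weylReflection (s : Fin 4) : O4 :=
  (Submodule.span ℝ {weylVector s})ᗮ.reflection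

/-- The Coxeter group `G`, generated by the four Weyl reflections. -/
noncomputable def coxeterG : Subgroup O4 :=
  Subgroup.closure (Set.range weylReflection)

/-- The Coxeter matrix of the diagram `∘ -4- ∘ -3- ∘ -3- ∘`. -/
def diagramMatrix : Matrix (Fin 4) (Fin 4) ℕ :=
  !![1, 4, 2, 2;
     4, 1, 3, 2;
     2, 3, 1, 3;
     2, 2, 3, 1]

/-! ### The generator `g₁` and the table of its powers.
Row `t : Fin 8` of each table belongs to the power `g₁ ^ (t + 1)`. -/

/-- The generator `g₁ : x ↦ (x 1, -x 3, x 0, x 2)`. -/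
noncomputable def g1 : O4 := signedPerm ![1, -1, 1, 1] c[0, 1, 3, 2]

/-- The column of images `g₁ ^ (t + 1) x`. -/
def actionTable (x : E4) : Fin 8 → E4 :=
  ![!₂[x 1, -x 3, x 0, x 2],
    !₂[-x 3, -x 2, x 1, x 0],
    !₂[-x 2, -x 0, -x 3, x 1],
    !₂[-x 0, -x 1, -x 2, -x 3],
    !₂[-x 1, x 3, -x 0, -x 2],
    !₂[x 3, x 2, -x 1, -x 0],
    !₂[x 2, x 0, x 3, -x 1],
    !₂[x 0, x 1, x 2, x 3]]

/-- The column of signs. -/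
def signTable : Fin 8 → Fin 4 → ℤˣ :=
  ![![1, -1, 1, 1],
    ![-1, -1, 1, 1],
    ![-1, -1, -1, 1],
    ![-1, -1, -1, -1],
    ![-1, 1, -1, -1],
    ![1, 1, -1, -1],
    ![1, 1, 1, -1],
    ![1, 1, 1, 1]]

/-- The column of permutations, in cycle form. -/
def permTable : Fin 8 → Equiv.Perm (Fin 4) :=
  ![c[0, 1, 3, 2],
    c[0, 3] * c[1, 2],
    c[0, 2, 3, 1],
    1,
    c[0, 1, 3, 2],
    c[0, 3] * c[1, 2],
    c[0, 2, 3, 1],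
    1]

/-- The matrix coordinates `u` of a point, with `z₁ = x 0 - i x 3`, `z₂ = -x 2 - i x 1`. -/
noncomputable def uCoord (x : E4) : Matrix (Fin 2) (Fin 2) ℂ :=
  !![(x 0 : ℂ) - Complex.I * x 3, -(x 2 : ℂ) - Complex.I * x 1;
     (x 2 : ℂ) - Complex.I * x 1, (x 0 : ℂ) + Complex.I * x 3]

/-- `a = exp (π i / 4)`. -/
noncomputable def aRoot : ℂ := Complex.exp (Real.pi * Complex.I / 4)

/-- The column of left factors `w_l ^ (t + 1)`. -/
noncomputable def wlTable : Fin 8 → Matrix (Fin 2) (Fin 2) ℂ :=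
  ![!![-star aRoot, 0; 0, -aRoot],
    !![star aRoot ^ 2, 0; 0, aRoot ^ 2],
    !![-star aRoot ^ 3, 0; 0, -aRoot ^ 3],
    !![-1, 0; 0, -1],
    !![star aRoot, 0; 0, aRoot],
    !![-star aRoot ^ 2, 0; 0, -aRoot ^ 2],
    !![star aRoot ^ 3, 0; 0, aRoot ^ 3],
    !![1, 0; 0, 1]]

/-- The column of right factors `w_r ^ (t + 1)`. -/
noncomputable def wrTable : Fin 8 → Matrix (Fin 2) (Fin 2) ℂ :=
  ![!![0, -aRoot ^ 3; -aRoot, 0],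
    !![-1, 0; 0, -1],
    !![0, aRoot ^ 3; aRoot, 0],
    !![1, 0; 0, 1],
    !![0, -aRoot ^ 3; -aRoot, 0],
    !![-1, 0; 0, -1],
    !![0, aRoot ^ 3; aRoot, 0],
    !![1, 0; 0, 1]]

/-! ### Deck transformations and the 8-cell -/

/-- The group of deck transformations of a map `q : E → X`: the self-homeomorphisms `h` of `E`
with `q ∘ h = q`. -/
def deckGroup {E X : Type*} [TopologicalSpace E] (q : E → X) : Subgroup (E ≃ₜ E) where
  carrier := {h | ∀ x, q (h x) = q x}
  one_mem' := fun _ => rfl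
  mul_mem' {h k} hh hk := fun x => (hh (k x)).trans (hk x)
  inv_mem' {h} hh := fun x => by
    have h1 := hh (h⁻¹ x)
    have h2 : h (h⁻¹ x) = x := h.apply_symm_apply x
    rw [h2] at h1
    exact h1.symm

/-- A universal covering: a covering map whose total space is simply connected. -/
def IsUniversalCovering {E X : Type*} [TopologicalSpace E] [TopologicalSpace X]
    (q : E → X) : Prop :=
  IsCoveringMap q ∧ SimplyConnectedSpace E

/-- The vector `(1, y₁, y₂, y₃)`. -/
def cubeLift (y : Cube) : E4 := !₂[1, y.1 0, y.1 1, y.1 2]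

lemma cubeLift_ne_zero (y : Cube) : cubeLift y ≠ 0 := by
  intro h
  have h0 : cubeLift y 0 = (0 : E4) 0 := by rw [h]
  simp [cubeLift] at h0

/-- The cube as spherical prototile centred at `(1, 0, 0, 0)`: `y` goes to the radial projection
of `(1, y)` to the 3-sphere. -/
noncomputable def prototileMap (y : Cube) : S3 :=
  ⟨‖cubeLift y‖⁻¹ • cubeLift y, by
    simp [norm_smul, norm_ne_zero_iff.mpr (cubeLift_ne_zero y)]⟩

/-- The spherical cubic prototile. -/
noncomputable def prototile : Set S3 := Set.range prototileMap

/-- The spherical cube centred at `± eᵢ` (sign `s`): the radial projection to the 3-sphere of the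
facet `x i = s` of the hypercube `[-1, 1]⁴`. -/
def sphericalCube (i : Fin 4) (s : ℤˣ) : Set S3 :=
  {x | ∀ j, |x.1 j| ≤ ((s : ℤ) : ℝ) * x.1 i}

/-- The 8-cell tiling of the 3-sphere: the set of its eight cells. -/
def eightCell : Set (Set S3) := {C | ∃ i s, C = sphericalCube i s}

/-! ### Signed permutations -/

/-! Why it holds: the three face gluings are restrictions to the prototile of powers of `g1`, namely
`g1 ^ 7`, `g1 ^ 2` and `g1 ^ 3`. Conversely, a power of `g1` that takes a point of the prototile to
a point of the prototile is the identity or one of these gluings or their inverses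
(`quot_mk_eq_of_g1_pow`). Every orbit meets the prototile, since the powers of `g1` permute the
eight cubes simply transitively. So the cube with glued faces is the orbit space of the cyclic group
on the 3-sphere (`C2.bijective_toOrbits`, then compactness).

A finite group acting freely gives a covering. The sphere is simply connected, so this covering is
universal, its deck group is the acting group, and the fundamental group is its opposite.

The rest rests on signed permutations: products, powers and equality of these are finite data, so
the tables of powers and the Coxeter relations are left to `decide`. The `SU(2)` factors need a
check only for the generator, followed by induction. -/

@[simp]
lemma signedPerm_apply (ε : Fin 4 → ℤˣ) (p : Equiv.Perm (Fin 4)) (x : E4) (i : Fin 4) :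
    signedPerm ε p x i = ((ε i : ℤ) : ℝ) * x (p i) := rfl

/-- Coordinates are pulled back along the permutations, so these compose in reverse order. -/
lemma signedPerm_mul (ε δ : Fin 4 → ℤˣ) (p q : Equiv.Perm (Fin 4)) :
    signedPerm ε p * signedPerm δ q = signedPerm (fun i => ε i * δ (p i)) (q * p) := by
  ext x i
  change signedPerm ε p (signedPerm δ q x) i = _
  simp [mul_assoc]

lemma signedPerm_one : signedPerm 1 1 = 1 := by
  ext x i
  simp

lemma signedPerm_injective {ε δ : Fin 4 → ℤˣ} {p q : Equiv.Perm (Fin 4)}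
    (h : signedPerm ε p = signedPerm δ q) : ε = δ ∧ p = q := by
  have key (i : Fin 4) : p i = q i ∧ ε i = δ i := by
    -- The basis vector at `p i` is the one that coordinate `i` of the image detects.
    have h1 : signedPerm ε p (EuclideanSpace.single (p i) 1) i
      = signedPerm δ q (EuclideanSpace.single (p i) 1) i := by rw [h]
    by_cases hpq : q i = p i
    · simp only [signedPerm_apply, PiLp.single_apply, hpq] at h1
      exact ⟨hpq.symm, by simpa [Units.ext_iff] using h1⟩
    · simp [hpq] at h1
  exact ⟨funext fun i => (key i).2, Equiv.ext fun i => (key i).1⟩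

lemma signedPerm_inv (ε : Fin 4 → ℤˣ) (p : Equiv.Perm (Fin 4)) :
    (signedPerm ε p)⁻¹ = signedPerm (fun i => ε (p⁻¹ i)) p⁻¹ := by
  rw [inv_eq_iff_mul_eq_one, signedPerm_mul, ← signedPerm_one]
  congr 1
  · funext i
    simp [Int.units_mul_self]
  · simp

lemma signedPerm_eq_one_iff (ε : Fin 4 → ℤˣ) (p : Equiv.Perm (Fin 4)) :
    signedPerm ε p = 1 ↔ ε = 1 ∧ p = 1 := by
  rw [← signedPerm_one]
  exact ⟨signedPerm_injective, fun h => by rw [h.1, h.2]⟩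

/-! ### The powers of the generator -/

lemma signTable_succ (t : Fin 7) :
    signTable t.succ = fun i => signTable t.castSucc i * signTable 0 (permTable t.castSucc i) := by
  revert t
  decide

lemma permTable_succ (t : Fin 7) :
    permTable t.succ = permTable 0 * permTable t.castSucc := by
  revert t
  decide

lemma g1_pow_eq_signedPerm (t : Fin 8) :
    g1 ^ (t.val + 1) = signedPerm (signTable t) (permTable t) := by
  induction t using Fin.induction with
  | zero => exact pow_one g1
  | succ t ih =>
    rw [signTable_succ, permTable_succ, ← signedPerm_mul, ← ih]
    exact pow_succ g1 _

lemma g1_apply (x : E4) : g1 x = !₂[x 1, -x 3, x 0, x 2] := by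
  have h : ∀ i, (c[0, 1, 3, 2] : Equiv.Perm (Fin 4)) i = ![1, 3, 0, 2] i := by decide
  ext i
  rw [g1, signedPerm_apply, h]
  match i with
  | 0 | 1 | 2 | 3 => simp

lemma actionTable_succ (x : E4) (t : Fin 7) :
    actionTable x t.succ = g1 (actionTable x t.castSucc) := by
  rw [g1_apply]
  ext i
  match t with
  | 0 | 1 | 2 | 3 | 4 | 5 | 6 => fin_cases i <;> simp [actionTable]

lemma g1_pow_apply (t : Fin 8) (x : E4) : (g1 ^ (t.val + 1)) x = actionTable x t := by
  induction t using Fin.induction with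
  | zero => exact (congrArg (· x) (pow_one g1)).trans (g1_apply x)
  | succ t ih =>
    rw [actionTable_succ, ← ih]
    exact congrArg (· x) (pow_succ' g1 _)

lemma orderOf_g1 : orderOf g1 = 8 := by
  refine orderOf_eq_prime_pow (p := 2) (n := 2) ?_ ?_
  · rw [show 2 ^ 2 = (3 : Fin 8).val + 1 from rfl, g1_pow_eq_signedPerm, signedPerm_eq_one_iff]
    decide
  · rw [show 2 ^ (2 + 1) = (7 : Fin 8).val + 1 from rfl, g1_pow_eq_signedPerm,
      signedPerm_eq_one_iff]
    decide

lemma mem_zpowers_g1_iff {A : O4} :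
    A ∈ Subgroup.zpowers g1 ↔ ∃ t : Fin 8, A = g1 ^ (t.val + 1) := by
  constructor
  · intro hA
    have hfin : IsOfFinOrder g1 := by rw [← orderOf_pos_iff, orderOf_g1]; norm_num
    obtain ⟨n, hn⟩ := (hfin.mem_powers_iff_mem_zpowers.mpr hA)
    -- Row `t` carries the exponent `t + 1`, so the row is `n - 1` modulo 8, and the identity sits
    -- in row 7.
    refine ⟨⟨(n + 7) % 8, Nat.mod_lt _ (by norm_num)⟩, ?_⟩
    rw [← hn]
    change g1 ^ n = g1 ^ ((n + 7) % 8 + 1)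
    rw [pow_inj_mod, orderOf_g1]
    omega
  · rintro ⟨t, rfl⟩
    exact Subgroup.npow_mem_zpowers _ _

/-! ### The powers of the generator in `SU(2)` coordinates -/

lemma aRoot_pow_four : aRoot ^ 4 = -1 := by
  rw [aRoot, ← Complex.exp_nat_mul, ← Complex.exp_pi_mul_I]
  congr 1
  push_cast
  ring

lemma conj_aRoot_mul_aRoot : (starRingEnd ℂ) aRoot * aRoot = 1 := by
  have h : (starRingEnd ℂ) aRoot = Complex.exp (-(Real.pi * Complex.I / 4)) := by
    rw [aRoot, ← Complex.exp_conj]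
    congr 1
    simp [neg_div, Complex.conj_ofNat]
  rw [h, aRoot, ← Complex.exp_add, neg_add_cancel, Complex.exp_zero]

lemma conj_aRoot_pow_four : (starRingEnd ℂ) aRoot ^ 4 = -1 := by
  rw [← map_pow, aRoot_pow_four, map_neg, map_one]

lemma wlTable_succ (t : Fin 7) : wlTable t.succ = wlTable t.castSucc * wlTable 0 := by
  have h1 := aRoot_pow_four
  have h2 := conj_aRoot_pow_four
  match t with
  | 0 | 1 | 2 | 3 | 4 | 5 | 6 => simp [wlTable] <;> grind

lemma wrTable_succ (t : Fin 7) : wrTable t.succ = wrTable t.castSucc * wrTable 0 := by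
  have h1 := aRoot_pow_four
  match t with
  | 0 | 1 | 2 | 3 | 4 | 5 | 6 => simp [wrTable] <;> grind

lemma wlTable_eq_pow (t : Fin 8) : wlTable t = wlTable 0 ^ (t.val + 1) := by
  induction t using Fin.induction with
  | zero => exact (pow_one _).symm
  | succ t ih =>
    rw [wlTable_succ, ih]
    exact (pow_succ _ _).symm

lemma wrTable_eq_pow (t : Fin 8) : wrTable t = wrTable 0 ^ (t.val + 1) := by
  induction t using Fin.induction with
  | zero => exact (pow_one _).symm
  | succ t ih =>
    rw [wrTable_succ, ih]
    exact (pow_succ _ _).symm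

lemma wlTable_mem (t : Fin 8) : wlTable t ∈ Matrix.specialUnitaryGroup (Fin 2) ℂ := by
  rw [wlTable_eq_pow]
  refine pow_mem (Matrix.mem_specialUnitaryGroup_iff.mpr
    ⟨Matrix.mem_unitaryGroup_iff.mpr ?_, ?_⟩) _
  · have h := conj_aRoot_mul_aRoot
    ext i j
    fin_cases i <;> fin_cases j <;>
      simp [wlTable, Matrix.mul_apply, Matrix.star_apply] <;> grind
  · simpa [wlTable, Matrix.det_fin_two] using conj_aRoot_mul_aRoot

lemma wrTable_mem (t : Fin 8) : wrTable t ∈ Matrix.specialUnitaryGroup (Fin 2) ℂ := by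
  rw [wrTable_eq_pow]
  have h := conj_aRoot_mul_aRoot
  have h1 := aRoot_pow_four
  have h2 := conj_aRoot_pow_four
  refine pow_mem (Matrix.mem_specialUnitaryGroup_iff.mpr
    ⟨Matrix.mem_unitaryGroup_iff.mpr ?_, ?_⟩) _
  · ext i j
    fin_cases i <;> fin_cases j <;>
      simp [wrTable, Matrix.mul_apply, Matrix.star_apply] <;> grind
  · simp [wrTable, Matrix.det_fin_two]
    grind

/-- Moving the left factor across avoids inverses, so that the identity iterates by induction. -/
lemma wlTable_mul_uCoord_g1 (x : E4) :
    wlTable 0 * uCoord (g1 x) = uCoord x * wrTable 0 := by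
  have h0 : g1 x = actionTable x 0 := by simpa using g1_pow_apply 0 x
  have h := conj_aRoot_mul_aRoot
  have h1 := aRoot_pow_four
  have h2 : aRoot ^ 2 = Complex.I := by
    rw [aRoot, ← Complex.exp_nat_mul]
    refine (congrArg Complex.exp ?_).trans Complex.exp_pi_div_two_mul_I
    push_cast
    ring
  have h3 := Complex.I_mul_I
  rw [h0]
  ext i j
  fin_cases i <;> fin_cases j <;>
    simp [wlTable, wrTable, uCoord, actionTable, Matrix.mul_apply] <;> grind

lemma wlTable_pow_mul_uCoord (n : ℕ) (x : E4) :
    wlTable 0 ^ n * uCoord ((g1 ^ n) x) = uCoord x * wrTable 0 ^ n := by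
  induction n with
  | zero => simp
  | succ n ih =>
    have h : (g1 ^ (n + 1)) x = g1 ((g1 ^ n) x) := by rw [pow_succ']; rfl
    rw [h, pow_succ, mul_assoc, wlTable_mul_uCoord_g1, ← mul_assoc, ih, mul_assoc, ← pow_succ]

lemma uCoord_g1_pow (t : Fin 8) (x : E4) :
    uCoord ((g1 ^ (t.val + 1)) x) = (wlTable t)⁻¹ * uCoord x * wrTable t := by
  have hdet : IsUnit (wlTable t).det := by
    rw [(Matrix.mem_specialUnitaryGroup_iff.mp (wlTable_mem t)).2]
    exact isUnit_one
  have h := wlTable_pow_mul_uCoord (t.val + 1) x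
  rw [← wlTable_eq_pow, ← wrTable_eq_pow] at h
  rw [mul_assoc, ← h, Matrix.nonsing_inv_mul_cancel_left _ _ hdet]

/-! ### Simple connectedness of spheres -/

open scoped unitInterval in
/-- A path in a normed space can be uniformly approximated by a smooth curve with the same
endpoints. -/
lemma Path.exists_contDiff_norm_sub_lt {E : Type*} [NormedAddCommGroup E] [NormedSpace ℝ E]
    {x y : E} (γ : Path x y) {ε : ℝ} (hε : 0 < ε) :
    ∃ f : ℝ → E, ContDiff ℝ 1 f ∧ f 0 = x ∧ f 1 = y ∧ ∀ t : I, ‖f t - γ t‖ < ε := by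
  -- Bernstein polynomials converge uniformly and keep the endpoints; degree 0 is excluded because
  -- it misses the value at 1.
  have h := (Metric.tendsto_nhds.mp (bernsteinApproximation_uniform (γ : C(I, E))) ε hε).and
    (Filter.eventually_ne_atTop 0)
  obtain ⟨n, hn, hn0⟩ := h.exists
  let f : ℝ → E := fun t => ∑ k : Fin (n + 1),
    ((n.choose k : ℝ) * t ^ (k : ℕ) * (1 - t) ^ (n - (k : ℕ))) • γ (bernstein.z k)
  have hf (t : I) : f t = bernsteinApproximation n (γ : C(I, E)) t := by
    rw [bernsteinApproximation.apply]
    exact Finset.sum_congr rfl fun k _ => by rw [bernstein_apply]; rfl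
  refine ⟨f, by fun_prop, ?_, ?_, fun t => ?_⟩
  · have := (hf 0).trans (bernsteinApproximation.apply_zero n (γ : C(I, E)))
    simpa using this
  · have := (hf 1).trans (bernsteinApproximation.apply_one hn0 (γ : C(I, E)))
    simpa using this
  · rw [hf, ← dist_eq_norm]
    exact (ContinuousMap.dist_apply_le_dist t).trans_lt hn

section Sphere

variable {E : Type*} [NormedAddCommGroup E] [NormedSpace ℝ E]

/-- The radial projection of the nonzero vectors to the unit sphere. -/
noncomputable def radialProj (v : {v : E // v ≠ 0}) : Metric.sphere (0 : E) 1 :=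
  ⟨‖v.1‖⁻¹ • v.1, by simp [norm_smul, norm_ne_zero_iff.mpr v.2]⟩

lemma continuous_radialProj : Continuous (radialProj : {v : E // v ≠ 0} → _) := by
  refine Continuous.subtype_mk (Continuous.smul (Continuous.inv₀ ?_ ?_) ?_) _
  · fun_prop
  · exact fun v => norm_ne_zero_iff.mpr v.2
  · fun_prop

lemma radialProj_of_norm_eq_one (v : {v : E // v ≠ 0}) (h : ‖v.1‖ = 1) :
    (radialProj v : E) = v.1 := by
  simp [radialProj, h]

/-- A smooth curve in a space of dimension at least three misses some direction. -/
lemma exists_smul_ne_of_contDiff [FiniteDimensional ℝ E] (hE : 2 < Module.finrank ℝ E)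
    {f : ℝ → E} (hf : ContDiff ℝ 1 f) : ∃ w : E, ∀ r t : ℝ, r • f t ≠ w := by
  -- The cone over the curve is a smooth image of the plane, so its complement is dense.
  have h : ContDiff ℝ 1 fun p : ℝ × ℝ => p.1 • f p.2 := by fun_prop
  obtain ⟨w, hw⟩ := (h.dense_compl_range_of_finrank_lt_finrank (by simpa using hE)).nonempty
  exact ⟨w, fun r t h => hw ⟨(r, t), h⟩⟩

open scoped unitInterval in
/-- In a space of dimension at least three, a path in the unit sphere is homotopic to a path
that misses a point. -/
lemma Path.exists_homotopic_sphere_notMem [FiniteDimensional ℝ E] (hE : 2 < Module.finrank ℝ E)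
    {x y : Metric.sphere (0 : E) 1} (γ : Path x y) :
    ∃ (γ' : Path x y) (v : Metric.sphere (0 : E) 1), γ.Homotopic γ' ∧ ∀ t, γ' t ≠ v := by
  obtain ⟨f, hf, hf0, hf1, hfγ⟩ :=
    (γ.map continuous_subtype_val).exists_contDiff_norm_sub_lt one_pos
  obtain ⟨w, hw⟩ := exists_smul_ne_of_contDiff hE hf
  have hw0 : w ≠ 0 := fun h => hw 0 0 (by simp [h])
  -- The segment from `γ t` to `f t` avoids the origin: `γ t` has norm one and `f t` is at distance
  -- less than one.
  have hne (s t : I) : (γ t : E) + (s : ℝ) • (f t - γ t) ≠ 0 := by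
    intro h
    have h1 : ‖(γ t : E)‖ = 1 := norm_eq_of_mem_sphere (γ t)
    rw [eq_neg_of_add_eq_zero_left h, norm_neg, norm_smul, Real.norm_of_nonneg s.2.1] at h1
    have h2 : ‖f t - γ t‖ < 1 := hfγ t
    nlinarith [s.2.1, s.2.2, norm_nonneg (f t - γ t)]
  let H : I × I → Metric.sphere (0 : E) 1 := fun p =>
    radialProj ⟨(γ p.2 : E) + (p.1 : ℝ) • (f p.2 - γ p.2), hne p.1 p.2⟩
  have hfc := hf.continuous
  have hH : Continuous H := continuous_radialProj.comp (Continuous.subtype_mk (by fun_prop) _)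
  have hHx (s : I) : H (s, 0) = x := by
    refine Subtype.ext ((radialProj_of_norm_eq_one _ ?_).trans ?_) <;> simp [hf0]
  have hHy (s : I) : H (s, 1) = y := by
    refine Subtype.ext ((radialProj_of_norm_eq_one _ ?_).trans ?_) <;> simp [hf1]
  have hHγ (t : I) : H (0, t) = γ t := by
    refine Subtype.ext ((radialProj_of_norm_eq_one _ ?_).trans ?_) <;> simp
  refine ⟨⟨⟨fun t => H (1, t), by fun_prop⟩, hHx 1, hHy 1⟩, radialProj ⟨w, hw0⟩, ⟨⟨⟨⟨H, hH⟩,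
    hHγ, fun t => rfl⟩, ?_⟩⟩, fun t h => ?_⟩
  · rintro s t (rfl | rfl)
    · exact (hHx s).trans γ.source.symm
    · exact (hHy s).trans γ.target.symm
  · have h1 : ‖f t‖⁻¹ • f t = ‖w‖⁻¹ • w := by
      simpa [H, radialProj, ← smul_add] using congrArg Subtype.val h
    refine hw (‖w‖ * ‖f t‖⁻¹) t ?_
    rw [mul_smul, h1, smul_inv_smul₀ (norm_ne_zero_iff.mpr hw0)]

end Sphere

section Sphere

variable {E : Type*} [NormedAddCommGroup E] [InnerProductSpace ℝ E]

/-- The complement of a point in the unit sphere is simply connected. -/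
lemma isSimplyConnected_compl_singleton_sphere (v : Metric.sphere (0 : E) 1) :
    IsSimplyConnected ({v}ᶜ : Set (Metric.sphere (0 : E) 1)) := by
  -- Stereographic projection identifies the punctured sphere with a whole vector space, which is
  -- contractible.
  let e := stereographic (norm_eq_of_mem_sphere v)
  have ht : IsSimplyConnected e.target :=
    (Homeomorph.Set.univ _).toHomotopyEquiv.simplyConnectedSpace
  have hs : IsSimplyConnected e.source :=
    have := ht.simplyConnectedSpace
    e.toHomeomorphSourceTarget.toHomotopyEquiv.simplyConnectedSpace
  exact hs

/-- The unit sphere of a Euclidean space of dimension at least three is simply connected. -/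
theorem simplyConnectedSpace_sphere [FiniteDimensional ℝ E] (hE : 2 < Module.finrank ℝ E) :
    SimplyConnectedSpace (Metric.sphere (0 : E) 1) := by
  rw [simply_connected_iff_loops_nullhomotopic]
  refine ⟨isPathConnected_iff_pathConnectedSpace.mp (isPathConnected_sphere ?_ 0 zero_le_one),
    fun x γ => ?_⟩
  · rw [← Module.finrank_eq_rank]
    exact_mod_cast (by omega : 1 < Module.finrank ℝ E)
  · obtain ⟨γ', v, hγ, hv⟩ := γ.exists_homotopic_sphere_notMem hE
    obtain ⟨F, -⟩ := (isSimplyConnected_iff_exists_homotopy_refl_forall_mem.mp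
      (isSimplyConnected_compl_singleton_sphere v)).2 x γ' hv
    exact hγ.trans ⟨F⟩

end Sphere

/-! ### The Coxeter group -/

/-- The signs of the Weyl reflections, as signed permutations. -/
def weylSign : Fin 4 → Fin 4 → ℤˣ := ![![1, 1, 1, -1], 1, 1, 1]

/-- The permutations underlying the Weyl reflections, as signed permutations. -/
def weylPerm : Fin 4 → Equiv.Perm (Fin 4) :=
  ![1, Equiv.swap 2 3, Equiv.swap 1 2, Equiv.swap 0 1]

lemma weylReflection_apply {s : Fin 4} (h : ‖weylVector s‖ = 1) (x : E4) :
    weylReflection s x = x - (2 * inner ℝ (weylVector s) x) • weylVector s := by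
  rw [weylReflection, Submodule.reflection_orthogonal_apply,
    Submodule.reflection_singleton_apply, h]
  simp [mul_smul, ofNat_smul_eq_nsmul]

lemma norm_weylVector (s : Fin 4) : ‖weylVector s‖ = 1 := by
  rw [EuclideanSpace.norm_eq, Real.sqrt_eq_one]
  match s with
  | 0 | 1 | 2 | 3 => simp [weylVector, Fin.sum_univ_four] <;> norm_num

lemma weylReflection_eq_signedPerm (s : Fin 4) :
    weylReflection s = signedPerm (weylSign s) (weylPerm s) := by
  have hsq : √2⁻¹ * √2⁻¹ = (2⁻¹ : ℝ) := Real.mul_self_sqrt (by norm_num)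
  ext x i
  rw [weylReflection_apply (norm_weylVector s)]
  simp only [PiLp.sub_apply, PiLp.smul_apply, smul_eq_mul, PiLp.inner_apply, Fin.sum_univ_four,
    signedPerm_apply]
  match s with
  | 0 | 1 | 2 | 3 =>
    fin_cases i <;> simp [weylVector, weylSign, weylPerm, Equiv.swap_apply_def] <;> grind

/-- With this closed form, the order of a signed permutation becomes a decidable question. -/
lemma signedPerm_pow (ε : Fin 4 → ℤˣ) (p : Equiv.Perm (Fin 4)) (n : ℕ) :
    signedPerm ε p ^ n =
      signedPerm (fun i => ∏ k ∈ Finset.range n, ε ((p ^ k) i)) (p ^ n) := by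
  induction n with
  | zero => exact signedPerm_one.symm
  | succ n ih =>
    rw [pow_succ', ih, signedPerm_mul, ← pow_succ]
    congr 1
    funext i
    rw [Finset.prod_range_succ', mul_comm]
    simp [pow_succ]

set_option maxRecDepth 10000 in
lemma orderOf_weylReflection_mul (s t : Fin 4) :
    orderOf (weylReflection s * weylReflection t) = diagramMatrix s t := by
  have hpos : 0 < diagramMatrix s t := by
    fin_cases s <;> fin_cases t <;> decide
  simp only [orderOf_eq_iff hpos, weylReflection_eq_signedPerm, signedPerm_mul, signedPerm_pow,
    ne_eq, signedPerm_eq_one_iff]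
  clear hpos
  fin_cases s <;> fin_cases t <;> decide

lemma signedPerm_one_mem_coxeterG (p : Equiv.Perm (Fin 4)) : signedPerm 1 p ∈ coxeterG := by
  have hp : p ∈ Submonoid.closure (Set.range fun i : Fin 3 => Equiv.swap i.castSucc i.succ) := by
    rw [Equiv.Perm.mclosure_swap_castSucc_succ]
    trivial
  induction hp using Submonoid.closure_induction with
  | mem p hp =>
    obtain ⟨i, rfl⟩ := hp
    -- The Weyl reflections list the adjacent transpositions in descending order, after the sign
    -- change at index 0.
    refine Subgroup.subset_closure ⟨i.rev.succ, ?_⟩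
    rw [weylReflection_eq_signedPerm]
    congr 1
    · revert i; decide
    · revert i; decide
  | one => exact signedPerm_one ▸ one_mem _
  | mul p q _ _ hp hq =>
    have h := mul_mem hq hp
    rw [signedPerm_mul] at h
    convert h using 2
    funext i
    simp

/-- Conjugating the sign change of the last coordinate by a transposition moves it to coordinate
`i`. -/
lemma signedPerm_update_mem_coxeterG (i : Fin 4) (e : ℤˣ) :
    signedPerm (Function.update 1 i e) 1 ∈ coxeterG := by
  have h0 : signedPerm (weylSign 0) (weylPerm 0) ∈ coxeterG :=
    Subgroup.subset_closure ⟨0, weylReflection_eq_signedPerm 0⟩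
  have h := mul_mem (mul_mem (signedPerm_one_mem_coxeterG (Equiv.swap 3 i)) h0)
    (signedPerm_one_mem_coxeterG (Equiv.swap 3 i))
  rw [signedPerm_mul, signedPerm_mul] at h
  rcases Int.units_eq_one_or e with rfl | rfl
  · have h1 : Function.update (1 : Fin 4 → ℤˣ) i 1 = 1 := Function.update_eq_self i 1
    rw [h1]
    exact signedPerm_one_mem_coxeterG 1
  · convert h using 2
    · clear h
      revert i
      decide
    · clear h
      revert i
      decide

lemma mem_coxeterG_iff (A : O4) : A ∈ coxeterG ↔ ∃ ε p, A = signedPerm ε p := by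
  constructor
  · intro hA
    induction hA using Subgroup.closure_induction with
    | mem A hA =>
      obtain ⟨s, rfl⟩ := hA
      exact ⟨_, _, weylReflection_eq_signedPerm s⟩
    | one => exact ⟨1, 1, signedPerm_one.symm⟩
    | mul A B _ _ hA hB =>
      obtain ⟨ε, p, rfl⟩ := hA
      obtain ⟨δ, q, rfl⟩ := hB
      exact ⟨_, _, signedPerm_mul ε δ p q⟩
    | inv A _ hA =>
      obtain ⟨ε, p, rfl⟩ := hA
      exact ⟨_, _, signedPerm_inv ε p⟩
  · rintro ⟨ε, p, rfl⟩
    have h := mul_mem (mul_mem (mul_mem (mul_mem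
      (signedPerm_update_mem_coxeterG 0 (ε 0)) (signedPerm_update_mem_coxeterG 1 (ε 1)))
      (signedPerm_update_mem_coxeterG 2 (ε 2))) (signedPerm_update_mem_coxeterG 3 (ε 3)))
      (signedPerm_one_mem_coxeterG p)
    simp only [signedPerm_mul] at h
    convert h using 2
    · funext i
      fin_cases i <;> simp [Function.update]
    · simp

/-- The hyperoctahedral group as the set of pairs of a sign vector and a permutation. -/
noncomputable def signedPermEquiv : (Fin 4 → ℤˣ) × Equiv.Perm (Fin 4) ≃ coxeterG :=
  Equiv.ofBijective (fun a => ⟨signedPerm a.1 a.2, (mem_coxeterG_iff _).mpr ⟨a.1, a.2, rfl⟩⟩)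
    ⟨fun _ _ h => Prod.ext_iff.mpr (signedPerm_injective (congrArg Subtype.val h)), fun A => by
      obtain ⟨ε, p, h⟩ := (mem_coxeterG_iff A.1).mp A.2
      exact ⟨(ε, p), Subtype.ext h.symm⟩⟩

lemma card_coxeterG : Nat.card coxeterG = 384 := by
  rw [← Nat.card_congr signedPermEquiv, Nat.card_eq_fintype_card, Fintype.card_prod,
    Fintype.card_perm, Fintype.card_fun, Fintype.card_fin]
  rfl

lemma coxeterG_lt_top : coxeterG < ⊤ := by
  refine lt_top_iff_ne_top.mpr fun h => ?_
  let v : E4 := !₂[1, 1, 1, 1]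
  let A : O4 := (Submodule.span ℝ {v}).reflection
  obtain ⟨ε, p, hA⟩ := (mem_coxeterG_iff A).mp (h ▸ Subgroup.mem_top A)
  -- Matrix entries of a signed permutation are 0 or ±1, whereas this one is 2 · (1/4) - 1.
  have h0 : A (EuclideanSpace.single 0 1) 0 = -2⁻¹ := by
    have hv : ‖v‖ ^ 2 = 4 := by
      rw [EuclideanSpace.norm_sq_eq]
      simp [v, Fin.sum_univ_four]
      norm_num
    simp only [A, Submodule.reflection_singleton_apply]
    simp [hv, v, PiLp.inner_apply]
    norm_num
  rw [hA, signedPerm_apply] at h0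
  rcases Int.units_eq_one_or (ε 0) with he | he <;> by_cases hp : p 0 = 0 <;>
    norm_num [he, hp] at h0

lemma zpowers_g1_lt_coxeterG : Subgroup.zpowers g1 < coxeterG := by
  refine lt_of_le_of_ne ?_ fun h => ?_
  · rw [Subgroup.zpowers_le, mem_coxeterG_iff]
    exact ⟨_, _, rfl⟩
  · have h1 := card_coxeterG
    rw [← h, Nat.card_zpowers, orderOf_g1] at h1
    norm_num at h1

/-! ### The eight spherical cubes -/

@[simp]
lemma sphereAct_coe (A : O4) (x : S3) : (sphereAct A x : E4) = A x := rfl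

lemma mem_sphericalCube {i : Fin 4} {s : ℤˣ} {x : S3} :
    x ∈ sphericalCube i s ↔ ∀ j, |x.1 j| ≤ ((s : ℤ) : ℝ) * x.1 i := Iff.rfl

lemma units_cast_mul_self (s : ℤˣ) : ((s : ℤ) : ℝ) * ((s : ℤ) : ℝ) = 1 := by
  rcases Int.units_eq_one_or s with rfl | rfl <;> simp

lemma abs_units_cast (s : ℤˣ) : |((s : ℤ) : ℝ)| = 1 := by
  rcases Int.units_eq_one_or s with rfl | rfl <;> simp

lemma units_cast_mul_le_abs (s : ℤˣ) (r : ℝ) : ((s : ℤ) : ℝ) * r ≤ |r| := by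
  rcases Int.units_eq_one_or s with rfl | rfl
  · simpa using le_abs_self r
  · simpa using neg_le_abs r

lemma S3_ne_zero (x : S3) : ∃ i, x.1 i ≠ 0 := by
  by_contra! h
  exact ne_zero_of_mem_unit_sphere x (PiLp.ext h)

lemma pos_of_mem_sphericalCube {i : Fin 4} {s : ℤˣ} {x : S3} (h : x ∈ sphericalCube i s) :
    0 < ((s : ℤ) : ℝ) * x.1 i := by
  obtain ⟨j, hj⟩ := S3_ne_zero x
  exact (abs_pos.mpr hj).trans_le (h j)

/-- Both sides are the largest absolute value of a coordinate; hence two cells overlap only where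
this linear equation holds. -/
lemma eq_of_mem_sphericalCube {i j : Fin 4} {s t : ℤˣ} {x : S3} (h : x ∈ sphericalCube i s)
    (h' : x ∈ sphericalCube j t) : ((s : ℤ) : ℝ) * x.1 i = ((t : ℤ) : ℝ) * x.1 j :=
  le_antisymm ((units_cast_mul_le_abs _ _).trans (h' i)) ((units_cast_mul_le_abs _ _).trans (h j))

lemma sphereAct_signedPerm_mem_sphericalCube {ε : Fin 4 → ℤˣ} {p : Equiv.Perm (Fin 4)}
    {i : Fin 4} {s : ℤˣ} {x : S3} :
    sphereAct (signedPerm ε p) x ∈ sphericalCube i s ↔ x ∈ sphericalCube (p i) (s * ε i) := by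
  simp only [mem_sphericalCube, sphereAct_coe, signedPerm_apply, abs_mul, abs_units_cast, one_mul,
    Units.val_mul, Int.cast_mul, ← mul_assoc]
  exact p.forall_congr_left.trans (by simp)

lemma sphereAct_signedPerm_image_sphericalCube (ε : Fin 4 → ℤˣ) (p : Equiv.Perm (Fin 4))
    (i : Fin 4) (s : ℤˣ) :
    sphereAct (signedPerm ε p) '' sphericalCube (p i) (s * ε i) = sphericalCube i s := by
  have h : sphericalCube (p i) (s * ε i) =
      sphereAct (signedPerm ε p) ⁻¹' sphericalCube i s :=
    Set.ext fun _ => sphereAct_signedPerm_mem_sphericalCube.symm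
  rw [h, Set.image_preimage_eq _ (sphereAct (signedPerm ε p)).surjective]

lemma sphericalCube_injective {i j : Fin 4} {s t : ℤˣ} (h : sphericalCube i s = sphericalCube j t) :
    i = j ∧ s = t := by
  -- The centre of a cell lies in no other cell.
  let x : S3 := ⟨EuclideanSpace.single i ((s : ℤ) : ℝ), by simp [abs_units_cast]⟩
  have hx : x ∈ sphericalCube i s := fun k => by
    by_cases hk : k = i
    · simp [x, hk, abs_units_cast, units_cast_mul_self]
    · simp [x, hk, units_cast_mul_self]
  have hx' := h ▸ hx
  have h1 := eq_of_mem_sphericalCube hx hx'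
  by_cases hij : j = i
  · refine ⟨hij.symm, ?_⟩
    subst hij
    have h2 : ((s : ℤ) : ℝ) ≠ 0 := by
      intro h0
      simpa [h0] using abs_units_cast s
    have h3 : ((s : ℤ) : ℝ) = ((t : ℤ) : ℝ) := by simpa [x, h2] using h1
    exact Units.ext (by exact_mod_cast h3)
  · simp [x, hij, units_cast_mul_self] at h1

lemma ncard_eightCell : eightCell.ncard = 8 := by
  have h : eightCell = Set.range fun a : Fin 4 × ℤˣ => sphericalCube a.1 a.2 := by
    ext C
    simp [eightCell, eq_comm]
  have hinj : Function.Injective fun a : Fin 4 × ℤˣ => sphericalCube a.1 a.2 :=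
    fun a b hab => Prod.ext_iff.mpr (sphericalCube_injective hab)
  rw [h, ← Set.image_univ, Set.ncard_image_of_injective _ hinj, Set.ncard_univ]
  simp

lemma exists_mem_sphericalCube (x : S3) : ∃ i s, x ∈ sphericalCube i s := by
  obtain ⟨i, hi⟩ := Finite.exists_max fun j => |x.1 j|
  rcases abs_choice (x.1 i) with h | h
  · exact ⟨i, 1, fun j => by simpa [h] using hi j⟩
  · exact ⟨i, -1, fun j => by simpa [h] using hi j⟩

lemma sUnion_eightCell : ⋃₀ eightCell = Set.univ := by
  refine Set.eq_univ_of_forall fun x => ?_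
  obtain ⟨i, s, h⟩ := exists_mem_sphericalCube x
  exact ⟨_, ⟨i, s, rfl⟩, h⟩

-- Opposite cells are disjoint by positivity. For different axes, a common interior point could be
-- moved slightly along the `i`-axis and renormalised without leaving either cell, although this
-- breaks the equation of `eq_of_mem_sphericalCube`.
open Filter Topology in
lemma disjoint_interior_sphericalCube {i j : Fin 4} {s t : ℤˣ} (h : ¬(i = j ∧ s = t)) :
    Disjoint (interior (sphericalCube i s)) (interior (sphericalCube j t)) := by
  rw [Set.disjoint_left]
  intro x hx hx'
  by_cases hij : i = j
  · subst hij
    have h1 := pos_of_mem_sphericalCube (interior_subset hx)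
    have h2 := eq_of_mem_sphericalCube (interior_subset hx) (interior_subset hx')
    have hts : t = -s := by
      rcases Int.units_eq_one_or s with rfl | rfl <;>
        rcases Int.units_eq_one_or t with rfl | rfl <;> simp_all
    rw [hts] at h2
    push_cast at h2
    linarith
  · obtain ⟨V, hV, hVU⟩ := (isOpen_interior (s := sphericalCube i s)).inter
      (isOpen_interior (s := sphericalCube j t))
    let v : E4 := EuclideanSpace.single i 1
    let f : ℝ → E4 := fun r => x.1 + r • v
    have hf : Continuous f := by fun_prop
    have hf0 : f 0 = x.1 := by simp [f]
    have hx1 : ‖x.1‖ = 1 := norm_eq_of_mem_sphere x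
    have hne : ∀ᶠ r in 𝓝 0, f r ≠ 0 := hf.continuousAt.eventually_ne (by
      rw [hf0, ← norm_ne_zero_iff, hx1]
      exact one_ne_zero)
    have hnorm : ContinuousAt (fun r => ‖f r‖⁻¹ • f r) 0 :=
      (hf.norm.continuousAt.inv₀ (by simp [hf0, hx1])).smul hf.continuousAt
    have hmem : ∀ᶠ r in 𝓝 0, ‖f r‖⁻¹ • f r ∈ V := hnorm.eventually_mem (hV.mem_nhds (by
      have : x ∈ Subtype.val ⁻¹' V := hVU ▸ ⟨hx, hx'⟩
      simpa [hf0, hx1] using this))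
    obtain ⟨r, ⟨hr0, hrV⟩, hr⟩ :=
      (((hne.and hmem).filter_mono nhdsWithin_le_nhds).and self_mem_nhdsWithin :
        ∀ᶠ r in 𝓝[≠] (0 : ℝ), _).exists
    have hz : radialProj ⟨f r, hr0⟩ ∈ Subtype.val ⁻¹' V := hrV
    rw [hVU] at hz
    have h1 := eq_of_mem_sphericalCube (interior_subset hx) (interior_subset hx')
    have h2 := eq_of_mem_sphericalCube (interior_subset hz.1) (interior_subset hz.2)
    have hn : ‖f r‖ ≠ 0 := norm_ne_zero_iff.mpr hr0
    have h3 : ((s : ℤ) : ℝ) * f r i = ((t : ℤ) : ℝ) * f r j := by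
      refine mul_left_cancel₀ (inv_ne_zero hn) ?_
      simpa [radialProj, mul_left_comm] using h2
    have h4 : ((s : ℤ) : ℝ) * r = 0 := by
      have h5 : j ≠ i := Ne.symm hij
      simp only [f, v, PiLp.add_apply, PiLp.smul_apply, PiLp.single_apply, smul_eq_mul, if_true,
        h5, if_false] at h3
      linarith
    have h6 := units_cast_mul_self s
    exact hr (Set.mem_singleton_iff.mpr (by linear_combination ((s : ℤ) : ℝ) * h4 - r * h6))

lemma pairwise_disjoint_interior_eightCell :
    eightCell.Pairwise fun C D => Disjoint (interior C) (interior D) := by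
  rintro _ ⟨i, s, rfl⟩ _ ⟨j, t, rfl⟩ h
  exact disjoint_interior_sphericalCube fun ⟨hi, hs⟩ => h (by rw [hi, hs])

lemma cubeLift_prototile (y : Cube) : ∃ c : ℝ, 0 < c ∧ (prototileMap y : E4) = c • cubeLift y :=
  ⟨‖cubeLift y‖⁻¹, inv_pos.mpr (norm_pos_iff.mpr (cubeLift_ne_zero y)), rfl⟩

lemma prototile_eq : prototile = sphericalCube 0 1 := by
  ext x
  constructor
  · rintro ⟨y, rfl⟩
    obtain ⟨c, hc, h⟩ := cubeLift_prototile y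
    intro j
    rw [h]
    have h0 := y.2 0
    have h1 := y.2 1
    have h2 := y.2 2
    fin_cases j <;> simp [cubeLift, abs_mul, abs_of_pos hc] <;> nlinarith
  · intro hx
    have h0 : 0 < x.1 0 := by simpa using pos_of_mem_sphericalCube hx
    have hy (i : Fin 3) : |x.1 i.succ / x.1 0| ≤ 1 := by
      rw [abs_div, abs_of_pos h0, div_le_one h0]
      simpa using hx i.succ
    let y : Cube := ⟨fun i => x.1 i.succ / x.1 0, hy⟩
    have hl : cubeLift y = (x.1 0)⁻¹ • x.1 := by
      ext i
      fin_cases i <;> simp [cubeLift, y, h0.ne', div_eq_inv_mul]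
    refine ⟨y, Subtype.ext ?_⟩
    have hx1 : ‖x.1‖ = 1 := norm_eq_of_mem_sphere x
    simp [prototileMap, hl, norm_smul, hx1, abs_of_pos h0, smul_smul, h0.ne']

/-! ### The covering of `C2` by the 3-sphere -/

/-- The group of homeomorphisms of the 3-sphere generated by `g1`. -/
noncomputable def g1Group : Subgroup (S3 ≃ₜ S3) := (Subgroup.zpowers g1).map sphereAct

lemma mem_g1Group_iff {h : S3 ≃ₜ S3} :
    h ∈ g1Group ↔ ∃ t : Fin 8, h = sphereAct (g1 ^ (t.val + 1)) := by
  simp only [g1Group, Subgroup.mem_map, mem_zpowers_g1_iff]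
  grind

lemma g1_pow_eq_self {t : Fin 8} {x : S3} (h : sphereAct (g1 ^ (t.val + 1)) x = x) : t = 7 := by
  have hx : ∀ i, actionTable x t i = x.1 i := fun i => by
    rw [← g1_pow_apply, ← sphereAct_coe, h]
  obtain ⟨i, hi⟩ := S3_ne_zero x
  have h0 := hx 0
  have h1 := hx 1
  have h2 := hx 2
  have h3 := hx 3
  by_contra ht
  refine hi ?_
  match t with
  | 0 | 1 | 2 | 3 | 4 | 5 | 6 =>
    simp [actionTable] at h0 h1 h2 h3
    fin_cases i <;> simp <;> linarith
  | 7 => exact absurd rfl ht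

lemma eq_one_of_mem_g1Group {h : S3 ≃ₜ S3} (hh : h ∈ g1Group) {x : S3} (hx : h x = x) :
    h = 1 := by
  obtain ⟨t, rfl⟩ := mem_g1Group_iff.mp hh
  rw [g1_pow_eq_self hx]
  have h8 : g1 ^ ((7 : Fin 8).val + 1) = 1 := by
    rw [show (7 : Fin 8).val + 1 = 8 from rfl, ← orderOf_g1, pow_orderOf_eq_one]
  rw [h8, map_one]

lemma nonempty_g1Group_mulEquiv : Nonempty (g1Group ≃* Multiplicative (ZMod 8)) := by
  have h : g1Group = Subgroup.zpowers (sphereAct g1) := MonoidHom.map_zpowers sphereAct g1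
  have hcard : Nat.card g1Group = 8 := by
    rw [h, Nat.card_zpowers]
    -- Freeness at the centre of the prototile shows that no order is lost in passing to
    -- homeomorphisms.
    have key (t : Fin 8) (ht : t ≠ 7) : sphereAct g1 ^ (t.val + 1) ≠ 1 := fun h =>
      ht (g1_pow_eq_self (x := prototileMap ⟨0, by simp⟩) (by rw [map_pow, h]; rfl))
    refine orderOf_eq_prime_pow (p := 2) (n := 2) (key 3 (by decide)) ?_
    rw [← map_pow, show 2 ^ (2 + 1) = 8 from rfl, ← orderOf_g1, pow_orderOf_eq_one, map_one]
  have : IsCyclic g1Group := by rw [h]; infer_instance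
  exact ⟨mulEquivOfCyclicCardEq (by simp [hcard])⟩

noncomputable instance : MulAction g1Group S3 where
  smul h x := h.1 x
  one_smul _ := rfl
  mul_smul _ _ _ := rfl

instance : ContinuousConstSMul g1Group S3 := ⟨fun h => h.1.continuous⟩

instance : Finite g1Group := nonempty_g1Group_mulEquiv.elim fun e => Finite.of_equiv _ e.symm.toEquiv

instance : IsCancelSMul g1Group S3 :=
  isCancelSMul_iff_eq_one_of_smul_eq.mpr fun h _ hx => Subtype.ext (eq_one_of_mem_g1Group h.2 hx)

/-- Linear isometries commute with radial projection, so gluings can be checked on the vectors `(1,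
y)`. -/
lemma sphereAct_prototileMap {A : O4} {y z : Cube} (h : A (cubeLift y) = cubeLift z) :
    sphereAct A (prototileMap y) = prototileMap z := by
  refine Subtype.ext ?_
  change A (‖cubeLift y‖⁻¹ • cubeLift y) = ‖cubeLift z‖⁻¹ • cubeLift z
  rw [← h, LinearIsometryEquiv.norm_map, map_smul]

lemma exists_g1_pow_of_cubeGlue {y z : Cube} (h : CubeGlue y.1 z.1) :
    ∃ t : Fin 8, sphereAct (g1 ^ (t.val + 1)) (prototileMap y) = prototileMap z := by
  obtain ⟨y, hy⟩ := y
  obtain ⟨z, hz⟩ := z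
  simp only at h
  have key {t : Fin 8} (h : actionTable (cubeLift ⟨y, hy⟩) t = cubeLift ⟨z, hz⟩) :
      ∃ t : Fin 8, sphereAct (g1 ^ (t.val + 1)) (prototileMap ⟨y, hy⟩) = prototileMap ⟨z, hz⟩ :=
    ⟨t, sphereAct_prototileMap ((g1_pow_apply t _).trans h)⟩
  cases h with
  | F3_F1 a b =>
    refine key (t := 6) ?_
    ext i
    fin_cases i <;> simp [actionTable, cubeLift]
  | F4_F2 a b =>
    refine key (t := 1) ?_
    ext i
    fin_cases i <;> simp [actionTable, cubeLift]
  | F5_F6 a b =>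
    refine key (t := 2) ?_
    ext i
    fin_cases i <;> simp [actionTable, cubeLift]

/-- The lifts differ by the power of `g1` and a factor `μ > 0`. For the six powers other than ±1,
one coordinate gives `1 = ±μ y_k` and another `z_l = ±μ`. The cube bounds then force `μ = 1`, which
puts both points on paired faces. The power `-1` would need `1 = -μ`. -/
lemma quot_mk_eq_of_g1_pow {y z : Cube} {t : Fin 8}
    (h : sphereAct (g1 ^ (t.val + 1)) (prototileMap y) = prototileMap z) :
    (Quot.mk _ y : C2) = Quot.mk _ z := by
  obtain ⟨c, hc, hcy⟩ := cubeLift_prototile y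
  obtain ⟨d, hd, hdz⟩ := cubeLift_prototile z
  have h1 : ∀ i, cubeLift z i = c / d * actionTable (cubeLift y) t i := fun i => by
    have h2 : c * actionTable (cubeLift y) t i = d * cubeLift z i := by
      rw [← g1_pow_apply, ← smul_eq_mul, ← smul_eq_mul, ← PiLp.smul_apply, ← PiLp.smul_apply,
        ← map_smul, ← hcy, ← hdz, ← h]
      rfl
    field_simp
    linarith
  have hμ : 0 < c / d := div_pos hc hd
  generalize c / d = μ at h1 hμ
  obtain ⟨y, hy⟩ := y
  obtain ⟨z, hz⟩ := z
  have hy0 := abs_le.mp (hy 0)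
  have hy1 := abs_le.mp (hy 1)
  have hy2 := abs_le.mp (hy 2)
  have hz0 := abs_le.mp (hz 0)
  have hz1 := abs_le.mp (hz 1)
  have hz2 := abs_le.mp (hz 2)
  have e0 := h1 0
  have e1 := h1 1
  have e2 := h1 2
  have e3 := h1 3
  clear h1 hcy hdz h
  have glue {u v : Fin 3 → ℝ} (h : CubeGlue u v) (hu : y = u) (hv : z = v) :
      (Quot.mk _ ⟨y, hy⟩ : C2) = Quot.mk _ ⟨z, hz⟩ := Quot.sound (by subst hu hv; exact h)
  have glue' {u v : Fin 3 → ℝ} (h : CubeGlue u v) (hu : z = u) (hv : y = v) :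
      (Quot.mk _ ⟨y, hy⟩ : C2) = Quot.mk _ ⟨z, hz⟩ :=
    (Quot.sound (by subst hu hv; exact h)).symm
  match t with
  | 0 =>
    simp [actionTable, cubeLift] at e0 e1 e2 e3
    have hμ1 : μ = 1 := by nlinarith
    subst hμ1
    refine glue' (.F3_F1 (z 0) (z 2)) ?_ ?_ <;> ext i <;> fin_cases i <;> simp <;> linarith
  | 1 =>
    simp [actionTable, cubeLift] at e0 e1 e2 e3
    have hμ1 : μ = 1 := by nlinarith
    subst hμ1
    refine glue (.F4_F2 (y 0) (y 1)) ?_ ?_ <;> ext i <;> fin_cases i <;> simp <;> linarith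
  | 2 =>
    simp [actionTable, cubeLift] at e0 e1 e2 e3
    have hμ1 : μ = 1 := by nlinarith
    subst hμ1
    refine glue (.F5_F6 (y 0) (y 2)) ?_ ?_ <;> ext i <;> fin_cases i <;> simp <;> linarith
  | 3 =>
    simp [actionTable, cubeLift] at e0
    linarith
  | 4 =>
    simp [actionTable, cubeLift] at e0 e1 e2 e3
    have hμ1 : μ = 1 := by nlinarith
    subst hμ1
    refine glue' (.F5_F6 (z 0) (z 2)) ?_ ?_ <;> ext i <;> fin_cases i <;> simp <;> linarith
  | 5 =>
    simp [actionTable, cubeLift] at e0 e1 e2 e3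
    have hμ1 : μ = 1 := by nlinarith
    subst hμ1
    refine glue' (.F4_F2 (z 0) (z 1)) ?_ ?_ <;> ext i <;> fin_cases i <;> simp <;> linarith
  | 6 =>
    simp [actionTable, cubeLift] at e0 e1 e2 e3
    have hμ1 : μ = 1 := by nlinarith
    subst hμ1
    refine glue (.F3_F1 (y 0) (y 2)) ?_ ?_ <;> ext i <;> fin_cases i <;> simp <;> linarith
  | 7 =>
    simp [actionTable, cubeLift] at e0 e1 e2 e3
    subst e0
    congr
    ext i
    fin_cases i <;> simp <;> linarith

/-- The gluing map from the cube to the orbit space of `g1Group`, through the prototile. -/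
noncomputable def C2.toOrbits : C2 → MulAction.orbitRel.Quotient g1Group S3 :=
  Quot.lift (fun y => Quotient.mk _ (prototileMap y)) fun y z h => by
    obtain ⟨t, ht⟩ := exists_g1_pow_of_cubeGlue h
    exact (Quotient.sound (s := MulAction.orbitRel g1Group S3)
      ⟨⟨_, mem_g1Group_iff.mpr ⟨t, rfl⟩⟩, ht⟩).symm

lemma continuous_prototileMap : Continuous prototileMap := by
  have h : Continuous cubeLift := by
    unfold cubeLift
    refine (PiLp.continuous_toLp 2 _).comp (continuous_pi fun i => ?_)
    have hc (j : Fin 3) : Continuous fun y : Cube => y.1 j :=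
      (continuous_apply j).comp continuous_subtype_val
    match i with
    | 0 => exact continuous_const
    | 1 => exact hc 0
    | 2 => exact hc 1
    | 3 => exact hc 2
  exact Continuous.subtype_mk
    ((h.norm.inv₀ fun y => norm_ne_zero_iff.mpr (cubeLift_ne_zero y)).smul h) _

instance : CompactSpace Cube := by
  have h : {y : Fin 3 → ℝ | ∀ i, |y i| ≤ 1} = Metric.closedBall 0 1 := by
    ext y
    simp [pi_norm_le_iff_of_nonneg]
  have hc := isCompact_closedBall (0 : Fin 3 → ℝ) 1
  rw [← h] at hc
  exact isCompact_iff_compactSpace.mp hc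

lemma exists_g1_pow_mem_prototile (x : S3) :
    ∃ t : Fin 8, sphereAct (g1 ^ (t.val + 1)) x ∈ prototile := by
  obtain ⟨i, s, h⟩ := exists_mem_sphericalCube x
  -- The first coordinates of the powers run through all `±x i`, so any cell can be brought to the
  -- prototile.
  have key : ∀ (i : Fin 4) (s : ℤˣ), ∃ t, permTable t 0 = i ∧ 1 * signTable t 0 = s := by decide
  obtain ⟨t, rfl, rfl⟩ := key i s
  exact ⟨t, by rwa [g1_pow_eq_signedPerm, prototile_eq, sphereAct_signedPerm_mem_sphericalCube]⟩

lemma C2.bijective_toOrbits : Function.Bijective C2.toOrbits := by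
  constructor
  · rintro ⟨y⟩ ⟨z⟩ h
    obtain ⟨⟨g, hg⟩, h⟩ := Quotient.exact h
    obtain ⟨t, rfl⟩ := mem_g1Group_iff.mp hg
    exact (quot_mk_eq_of_g1_pow h).symm
  · rintro ⟨x⟩
    obtain ⟨t, y, hy⟩ := exists_g1_pow_mem_prototile x
    exact ⟨Quot.mk _ y, Quotient.sound ⟨⟨_, mem_g1Group_iff.mpr ⟨t, rfl⟩⟩, hy.symm⟩⟩

/-- The glued cube is homeomorphic to the orbit space of `g1Group`. -/
noncomputable def C2.homeoOrbits : C2 ≃ₜ MulAction.orbitRel.Quotient g1Group S3 :=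
  -- The glued cube is compact and the orbit space of a finite group is Hausdorff, so a continuous
  -- bijection suffices.
  Continuous.homeoOfEquivCompactToT2 (f := Equiv.ofBijective _ C2.bijective_toOrbits)
    (continuous_quot_lift _ (continuous_quotient_mk'.comp continuous_prototileMap))

/-- The covering of the glued cube by the 3-sphere. -/
noncomputable def C2.covering : S3 → C2 := C2.homeoOrbits.symm ∘ Quotient.mk _

lemma C2.covering_prototileMap (y : Cube) : C2.covering (prototileMap y) = Quot.mk _ y :=
  C2.homeoOrbits.symm_apply_apply (Quot.mk _ y)

lemma C2.isQuotientCoveringMap_covering : IsQuotientCoveringMap C2.covering g1Group :=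
  isQuotientCoveringMap_quotientMk_of_properlyDiscontinuousSMul.homeomorph_comp _

/-! ### Deck group and fundamental group -/

instance : SimplyConnectedSpace S3 := simplyConnectedSpace_sphere (by simp)

/-- Fibres are orbits, so a deck transformation agrees with a group element at one point, hence
everywhere by uniqueness of lifts on the connected sphere. -/
lemma deckGroup_covering : deckGroup C2.covering = g1Group := by
  have hq := C2.isQuotientCoveringMap_covering
  ext h
  constructor
  · intro hh
    let x₀ : S3 := Classical.arbitrary S3
    obtain ⟨g, hg⟩ := hq.apply_eq_iff_mem_orbit.mp (hh x₀)
    have heq : ⇑h = ⇑g.1 := hq.isCoveringMap.eq_of_comp_eq h.continuous g.1.continuous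
      (funext fun x => (hh x).trans (hq.map_smul g).symm) x₀ hg.symm
    rw [show h = g.1 from Homeomorph.ext (congrFun heq)]
    exact g.2
  · exact fun hh x => hq.map_smul (⟨h, hh⟩ : g1Group)

lemma nonempty_fundamentalGroup_mulEquiv (c : C2) :
    Nonempty (FundamentalGroup C2 c ≃* Multiplicative (ZMod 8)) := by
  have hq := C2.isQuotientCoveringMap_covering
  obtain ⟨x, hx⟩ := hq.surjective c
  obtain ⟨e⟩ := nonempty_g1Group_mulEquiv
  -- The fundamental group is the opposite of the acting group; inversion removes the opposite.
  exact ⟨(hq.fundamentalGroupEquiv ⟨x, hx⟩).trans ((MulEquiv.inv' _).symm.trans e)⟩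

/-! ### The cells as translates of the prototile -/

lemma sphereAct_g1_pow_image_prototile (t : Fin 8) :
    sphereAct (g1 ^ (t.val + 1)) '' prototile =
      sphericalCube ((permTable t).symm 0) (signTable t ((permTable t).symm 0)) := by
  have h := sphereAct_signedPerm_image_sphericalCube (signTable t) (permTable t)
    ((permTable t).symm 0) (signTable t ((permTable t).symm 0))
  rwa [Equiv.apply_symm_apply, Int.units_mul_self, ← prototile_eq, ← g1_pow_eq_signedPerm] at h

/-- Simple transitivity on the signed axes: the axis and sign of the image cell determine the row,
and every pair occurs. -/
lemma bijOn_image_prototile :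
    Set.BijOn (fun h : S3 ≃ₜ S3 => h '' prototile) (g1Group : Set (S3 ≃ₜ S3)) eightCell := by
  have inj : ∀ t t' : Fin 8, (permTable t).symm 0 = (permTable t').symm 0 →
      signTable t ((permTable t).symm 0) = signTable t' ((permTable t').symm 0) → t = t' := by
    decide
  have surj : ∀ (i : Fin 4) (s : ℤˣ), ∃ t, (permTable t).symm 0 = i ∧ signTable t i = s := by
    decide
  refine ⟨fun h hh => ?_, fun h hh h' hh' heq => ?_, ?_⟩
  · obtain ⟨t, rfl⟩ := mem_g1Group_iff.mp hh
    exact ⟨_, _, sphereAct_g1_pow_image_prototile t⟩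
  · obtain ⟨t, rfl⟩ := mem_g1Group_iff.mp hh
    obtain ⟨t', rfl⟩ := mem_g1Group_iff.mp hh'
    simp only [sphereAct_g1_pow_image_prototile] at heq
    obtain ⟨h1, h2⟩ := sphericalCube_injective heq
    rw [inj t t' h1 h2]
  · rintro _ ⟨i, s, rfl⟩
    obtain ⟨t, rfl, rfl⟩ := surj i s
    exact ⟨_, mem_g1Group_iff.mpr ⟨t, rfl⟩, sphereAct_g1_pow_image_prototile t⟩

lemma sphereAct_g1_inv_prototileMap {y z : Cube} (hy : y.1 1 = 1)
    (hz : z.1 = ![1, y.1 2, -y.1 0]) :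
    sphereAct g1⁻¹ (prototileMap y) = prototileMap z := by
  refine sphereAct_prototileMap ?_
  have h : cubeLift y = g1 (cubeLift z) := by
    rw [g1_apply]
    ext i
    fin_cases i <;> simp [cubeLift, hy, hz]
  rw [h]
  exact g1.symm_apply_apply _

theorem mainTheorem1 :
    -- the fundamental group is cyclic of order eight
    (∀ c : C2, Nonempty (FundamentalGroup C2 c ≃* Multiplicative (ZMod 8))) ∧
    -- the group of deck transformations on the universal cover, the 3-sphere
    (∃ q : S3 → C2, IsUniversalCovering q ∧
      (∀ y : Cube, q (prototileMap y) = Quot.mk _ y) ∧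
      deckGroup q = (Subgroup.zpowers g1).map sphereAct ∧
      Nonempty (deckGroup q ≃* Multiplicative (ZMod 8)) ∧
      -- it acts without fixed points
      (∀ h ∈ deckGroup q, h ≠ 1 → ∀ x, h x ≠ x) ∧
      -- it generates the 8-cell from the prototile, each cell once
      Set.BijOn (fun h : S3 ≃ₜ S3 => h '' prototile) (deckGroup q : Set (S3 ≃ₜ S3)) eightCell) ∧
    -- the 8-cell is a tiling of the 3-sphere by eight cells
    (eightCell.ncard = 8 ∧ ⋃₀ eightCell = Set.univ ∧
      eightCell.Pairwise fun C D => Disjoint (interior C) (interior D)) ∧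
    -- the inverse point map of `g₁` performs the gluing of `F3` to `F1`
    (∀ y z : Cube, y.1 1 = 1 → z.1 = ![1, y.1 2, -y.1 0] →
      sphereAct g1⁻¹ (prototileMap y) = prototileMap z) ∧
    -- the generator has order eight, and its powers act as in the table
    orderOf g1 = 8 ∧
    (∀ t : Fin 8,
      (∀ x : E4, (g1 ^ (t.val + 1)) x = actionTable x t) ∧
      wlTable t ∈ Matrix.specialUnitaryGroup (Fin 2) ℂ ∧
      wrTable t ∈ Matrix.specialUnitaryGroup (Fin 2) ℂ ∧
      wlTable t = wlTable 0 ^ (t.val + 1) ∧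
      wrTable t = wrTable 0 ^ (t.val + 1) ∧
      (∀ x : E4, uCoord ((g1 ^ (t.val + 1)) x) = (wlTable t)⁻¹ * uCoord x * wrTable t) ∧
      g1 ^ (t.val + 1) = signedPerm (signTable t) (permTable t)) ∧
    -- the group `G` has the stated diagram and is the hyperoctahedral group
    (∀ s t : Fin 4, orderOf (weylReflection s * weylReflection t) = diagramMatrix s t) ∧
    (∀ A : O4, A ∈ coxeterG ↔ ∃ ε p, A = signedPerm ε p) ∧
    Nat.card coxeterG = 384 ∧
    -- the chain `O(4, ℝ) > G > C₈`
    coxeterG < ⊤ ∧ Subgroup.zpowers g1 < coxeterG := by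
  refine ⟨nonempty_fundamentalGroup_mulEquiv, ⟨C2.covering,
    ⟨C2.isQuotientCoveringMap_covering.isCoveringMap, inferInstance⟩, C2.covering_prototileMap,
    deckGroup_covering, deckGroup_covering ▸ nonempty_g1Group_mulEquiv, fun h hh hne x hx => ?_,
    deckGroup_covering ▸ bijOn_image_prototile⟩,
    ⟨ncard_eightCell, sUnion_eightCell, pairwise_disjoint_interior_eightCell⟩,
    fun _ _ => sphereAct_g1_inv_prototileMap, orderOf_g1, fun t => ⟨g1_pow_apply t, wlTable_mem t,
    wrTable_mem t, wlTable_eq_pow t, wrTable_eq_pow t, uCoord_g1_pow t, g1_pow_eq_signedPerm t⟩,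
    orderOf_weylReflection_mul, mem_coxeterG_iff, card_coxeterG, coxeterG_lt_top,
    zpowers_g1_lt_coxeterG⟩
  rw [deckGroup_covering] at hh
  exact hne (eq_one_of_mem_g1Group hh hx)
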